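/- Let $\mathbb{H}$ be the real quaternions, with conjugation $q\mapsto\overline q$ and norm $|q|$; let $\mathrm{Im}(\mathbb{H})=\{q : \overline q=-q\}$ and $\mathbb{S}=\{q\in \mathrm{Im}(\mathbb{H}) : |q|=1\}$. Let $\mathsf{H}\neq\{0\}$ be a quaternionic Hilbert space, i.e. a right $\mathbb{H}$-module with an $\mathbb{H}$-valued scalar product $\langle u|v\rangle$ that is right $\mathbb{H}$-linear in $v$, satisfies $\langle u|v\rangle=\overline{\langle v|u\rangle}$, is positive definite, and is complete for the norm $\|u\|=\sqrt{\langle u|u\rangle}$. An operator $T:D(T)\to\mathsf{H}$ is a right $\mathbb{H}$-linear map on a right $\mathbb{H}$-linear subspace $D(T)\subset\mathsf{H}$; $\mathfrak{B}(\mathsf{H})$ is the set of bounded operators with $D(T)=\mathsf{H}$. Compositions are taken on their natural domains. If $D(T)$ is dense, the adjoint $T^*$ has domain $\{u : \exists w\ \forall v\in D(T),\ \langle w|v\rangle=\langle u|Tv\rangle\}$ and $T^*u=w$. $T$ is self-adjoint if $T=T^*$, anti self-adjoint if $T=-T^*$ (equality of domains included), normal if $T\in\mathfrak{B}(\mathsf{H})$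 and $TT^*=T^*T$, unitary if $D(T)=\mathsf{H}$ and $TT^*=T^*T=I$. For $q\in\mathbb{H}$ let $\Delta_q(T)=T^2-T(q+\overline q)+I|q|^2$ on $D(T^2)$, where real scalars act by right multiplication. The spherical resolvent set $\rho_S(T)$ is the set of $q$ such that $\mathrm{Ker}\,\Delta_q(T)=\{0\}$, $\mathrm{Ran}\,\Delta_q(T)$ is dense, and $\Delta_q(T)^{-1}:\mathrm{Ran}\,\Delta_q(T)\to D(T^2)$ is bounded; the spherical spectrum is $\sigma_S(T)=\mathbb{H}\setminus\rho_S(T)$. It is the disjoint union of the point spectrum $\sigma_{pS}(T)$, where $\mathrm{Ker}\,\Delta_q(T)\ne\{0\}$; the residual spectrum $\sigma_{rS}(T)$, where the kernel is $\{0\}$ and the range is not dense; and the continuous spectrum $\sigma_{cS}(T)$, where the kernel is $\{0\}$, the range is dense and $\Delta_q(T)^{-1}$ is not bounded. **Theorem.** Let $T:D(T)\to\mathsf{H}$ be an operator with dense domain. (a) If $T\in\mathfrak{B}(\mathsf{H})$ is normal, then (i) $\sigma_{pS}(T)=\sigma_{pS}(T^*)$; (ii) $\sigma_{rS}(T)=\sigma_{rS}(T^*)=\emptyset$;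 (iii) $\sigma_{cS}(T)=\sigma_{cS}(T^*)$. (b) If $T$ is self-adjoint (not necessarily in $\mathfrak{B}(\mathsf{H})$), then $\sigma_S(T)\subset\mathbb{R}$ and $\sigma_{rS}(T)=\emptyset$. (c) If $T$ is anti self-adjoint (not necessarily in $\mathfrak{B}(\mathsf{H})$), then $\sigma_S(T)\subset\mathrm{Im}(\mathbb{H})$ and $\sigma_{rS}(T)=\emptyset$. (d) If $T\in\mathfrak{B}(\mathsf{H})$ is unitary, then $\sigma_S(T)\subset\{q\in\mathbb{H} : |q|=1\}$. (e) If $T\in\mathfrak{B}(\mathsf{H})$ is anti self-adjoint and unitary, then $\sigma_S(T)=\sigma_{pS}(T)=\mathbb{S}$. -/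

import Mathlib

open scoped Quaternion

/-- A Hermitean quaternionic scalar product on a right `ℍ`-module `H` (a module over `ℍᵐᵒᵖ`, with
`u q = MulOpposite.op q • u`), inducing the norm of `H`. The last field says that `⟪u, u⟫` is the
non-negative real number `‖u‖ ^ 2`; positivity and definiteness are contained in it.
A quaternionic Hilbert space is a complete space of this kind. -/
class QuaternionicInnerProductSpace (H : Type*) [NormedAddCommGroup H] [Module ℍᵐᵒᵖ H]
    extends Inner ℍ H where
  inner_add_right : ∀ u v w : H, inner u (v + w) = inner u v + inner u w
  inner_smul_right : ∀ (u v : H) (q : ℍ), inner u (MulOpposite.op q • v) = inner u v * q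
  star_inner : ∀ u v : H, star (inner v u) = inner u v
  inner_self : ∀ u : H, inner u u = ((‖u‖ ^ 2 : ℝ) : ℍ)

namespace QuatOp

section Quaternions

/-- The imaginary quaternions. -/
def imaginary : Set ℍ := {q | q = q.im}

/-- The real quaternions. -/
def real : Set ℍ := Set.range ((↑) : ℝ → ℍ)

/-- The sphere of unit imaginary quaternions. -/
def unitSphere : Set ℍ := {q | q ∈ imaginary ∧ ‖q‖ = 1}

/-- `q + star q` is real, hence central. -/
theorem add_star_comm (q p : ℍ) : p * (q + star q) = (q + star q) * p := by
  have h : q + star q = ((2 * q.re : ℝ) : ℍ) := by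
    rw [Quaternion.self_add_star']
  rw [h]
  exact (Quaternion.coe_commutes _ _).symm

end Quaternions

variable {H : Type*} [NormedAddCommGroup H] [Module ℍᵐᵒᵖ H]

/-- The identity operator on all of `H`. -/
noncomputable def one : H →ₗ.[ℍᵐᵒᵖ] H := LinearMap.id.toPMap ⊤

/-- The composition `S T` on its natural domain `{x ∈ D(T) | T x ∈ D(S)}`. -/
noncomputable def mul (S T : H →ₗ.[ℍᵐᵒᵖ] H) : H →ₗ.[ℍᵐᵒᵖ] H where
  domain :=
    { carrier := {x | ∃ hx : x ∈ T.domain, T ⟨x, hx⟩ ∈ S.domain}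
      zero_mem' := ⟨T.domain.zero_mem, by
        have h : T ⟨0, T.domain.zero_mem⟩ = 0 := T.map_zero
        rw [h]; exact S.domain.zero_mem⟩
      add_mem' := by
        rintro x y ⟨hx, hx'⟩ ⟨hy, hy'⟩
        refine ⟨T.domain.add_mem hx hy, ?_⟩
        have h : T ⟨x + y, T.domain.add_mem hx hy⟩ = T ⟨x, hx⟩ + T ⟨y, hy⟩ :=
          T.map_add ⟨x, hx⟩ ⟨y, hy⟩
        rw [h]; exact S.domain.add_mem hx' hy'
      smul_mem' := by
        rintro c x ⟨hx, hx'⟩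
        refine ⟨T.domain.smul_mem c hx, ?_⟩
        have h : T ⟨c • x, T.domain.smul_mem c hx⟩ = c • T ⟨x, hx⟩ := T.map_smul c ⟨x, hx⟩
        rw [h]; exact S.domain.smul_mem c hx' }
  toFun :=
    { toFun := fun x => S ⟨T ⟨x.1, x.2.1⟩, x.2.2⟩
      map_add' := by
        rintro ⟨x, hx, hx'⟩ ⟨y, hy, hy'⟩
        rw [← S.map_add]
        congr 1
        exact Subtype.ext (T.map_add ⟨x, hx⟩ ⟨y, hy⟩)
      map_smul' := by
        rintro c ⟨x, hx, hx'⟩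
        rw [RingHom.id_apply, ← S.map_smul]
        congr 1
        exact Subtype.ext (T.map_smul c ⟨x, hx⟩) }

/-- The operator `Δ_q(T) = T² - T (q + q̄) + I |q|²` on `D(T²)`. -/
noncomputable def delta (T : H →ₗ.[ℍᵐᵒᵖ] H) (q : ℍ) : H →ₗ.[ℍᵐᵒᵖ] H where
  domain := (mul T T).domain
  toFun :=
    { toFun := fun x => mul T T x - MulOpposite.op (q + star q) • T ⟨x.1, x.2.1⟩
        + MulOpposite.op ((‖q‖ ^ 2 : ℝ) : ℍ) • x.1
      map_add' := by
        rintro ⟨x, hx, hx'⟩ ⟨y, hy, hy'⟩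
        have h : T ⟨x + y, T.domain.add_mem hx hy⟩ = T ⟨x, hx⟩ + T ⟨y, hy⟩ :=
          T.map_add ⟨x, hx⟩ ⟨y, hy⟩
        rw [LinearPMap.map_add]
        change _ - _ • T ⟨x + y, T.domain.add_mem hx hy⟩ + _ • (x + y) = _
        rw [h, smul_add, smul_add]
        abel
      map_smul' := by
        rintro c ⟨x, hx, hx'⟩
        have h : T ⟨c • x, T.domain.smul_mem c hx⟩ = c • T ⟨x, hx⟩ := T.map_smul c ⟨x, hx⟩
        have h₁ : MulOpposite.op (q + star q) * c = c * MulOpposite.op (q + star q) :=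
          MulOpposite.unop_injective (add_star_comm q c.unop)
        have h₂ : MulOpposite.op ((‖q‖ ^ 2 : ℝ) : ℍ) * c
            = c * MulOpposite.op ((‖q‖ ^ 2 : ℝ) : ℍ) :=
          MulOpposite.unop_injective (Quaternion.coe_commutes _ _).symm
        rw [LinearPMap.map_smul]
        change _ - _ • T ⟨c • x, T.domain.smul_mem c hx⟩ + _ • (c • x) = _
        rw [h, smul_smul, smul_smul, h₁, h₂, RingHom.id_apply, smul_add, smul_sub, smul_smul,
          smul_smul] }

/-- Boundedness of an operator on its own domain. -/
def IsBdd (T : H →ₗ.[ℍᵐᵒᵖ] H) : Prop := ∃ K : ℝ, ∀ u : T.domain, ‖T u‖ ≤ K * ‖(u : H)‖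

/-- `𝔅(H)`: the bounded operators defined on all of `H`. -/
def boundedOperators (H : Type*) [NormedAddCommGroup H] [Module ℍᵐᵒᵖ H] :
    Set (H →ₗ.[ℍᵐᵒᵖ] H) := {T | T.domain = ⊤ ∧ IsBdd T}

/-- The kernel of an operator, as a subspace of its domain. -/
noncomputable def ker (T : H →ₗ.[ℍᵐᵒᵖ] H) : Submodule ℍᵐᵒᵖ T.domain := LinearMap.ker T.toFun

/-- The range of an operator. -/
noncomputable def ran (T : H →ₗ.[ℍᵐᵒᵖ] H) : Submodule ℍᵐᵒᵖ H := LinearMap.range T.toFun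

/-- The spherical resolvent set. -/
noncomputable def resolventSet (T : H →ₗ.[ℍᵐᵒᵖ] H) : Set ℍ :=
  {q | ker (delta T q) = ⊥ ∧ Dense (ran (delta T q) : Set H) ∧ IsBdd (delta T q).inverse}

/-- The spherical spectrum. -/
noncomputable def spectrum (T : H →ₗ.[ℍᵐᵒᵖ] H) : Set ℍ := (resolventSet T)ᶜ

/-- The spherical point spectrum. -/
def pointSpectrum (T : H →ₗ.[ℍᵐᵒᵖ] H) : Set ℍ := {q | ker (delta T q) ≠ ⊥}

/-- The spherical residual spectrum. -/
def residualSpectrum (T : H →ₗ.[ℍᵐᵒᵖ] H) : Set ℍ :=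
  {q | ker (delta T q) = ⊥ ∧ closure (ran (delta T q) : Set H) ≠ Set.univ}

/-- The spherical continuous spectrum. -/
def continuousSpectrum (T : H →ₗ.[ℍᵐᵒᵖ] H) : Set ℍ :=
  {q | ker (delta T q) = ⊥ ∧ closure (ran (delta T q) : Set H) = Set.univ ∧
    ¬ IsBdd (delta T q).inverse}

section Adjoint

variable [QuaternionicInnerProductSpace H]

theorem inner_zero_right (u : H) : inner ℍ u (0 : H) = 0 := by
  have h := QuaternionicInnerProductSpace.inner_add_right u 0 0
  rw [add_zero] at h
  exact left_eq_add.mp h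

theorem inner_add_left (u v w : H) : inner ℍ (u + v) w = inner ℍ u w + inner ℍ v w := by
  rw [← QuaternionicInnerProductSpace.star_inner (u + v) w,
    QuaternionicInnerProductSpace.inner_add_right, star_add,
    QuaternionicInnerProductSpace.star_inner, QuaternionicInnerProductSpace.star_inner]

theorem inner_smul_left (u v : H) (q : ℍ) :
    inner ℍ (MulOpposite.op q • u) v = star q * inner ℍ u v := by
  rw [← QuaternionicInnerProductSpace.star_inner _ v,
    QuaternionicInnerProductSpace.inner_smul_right, star_mul,
    QuaternionicInnerProductSpace.star_inner]

/-- A vector orthogonal to a dense set vanishes. -/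
theorem eq_zero_of_dense {s : Set H} (hs : Dense s) {z : H} (hz : ∀ v ∈ s, inner ℍ z v = 0) :
    z = 0 := by
  by_contra hne
  obtain ⟨v, hv, hdist⟩ := hs.exists_dist_lt z (norm_pos_iff.mpr hne)
  obtain ⟨w, rfl⟩ : ∃ w, v = z + w := ⟨v - z, by abel⟩
  have h0 := hz _ hv
  have h1 : inner ℍ (z + w) z = 0 := by
    rw [← QuaternionicInnerProductSpace.star_inner, h0, star_zero]
  have e1 : inner ℍ z w = -((‖z‖ ^ 2 : ℝ) : ℍ) := by
    rw [QuaternionicInnerProductSpace.inner_add_right,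
      QuaternionicInnerProductSpace.inner_self] at h0
    exact eq_neg_of_add_eq_zero_right h0
  have e2 : inner ℍ w z = -((‖z‖ ^ 2 : ℝ) : ℍ) := by
    rw [inner_add_left, QuaternionicInnerProductSpace.inner_self] at h1
    exact eq_neg_of_add_eq_zero_right h1
  have h2 := QuaternionicInnerProductSpace.inner_self (z + w)
  rw [inner_add_left, QuaternionicInnerProductSpace.inner_add_right,
    QuaternionicInnerProductSpace.inner_add_right, e1, e2,
    QuaternionicInnerProductSpace.inner_self, QuaternionicInnerProductSpace.inner_self] at h2
  have h3 : ‖z‖ ^ 2 + -‖z‖ ^ 2 + (-‖z‖ ^ 2 + ‖w‖ ^ 2) = ‖z + w‖ ^ 2 := by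
    refine Quaternion.coe_injective ?_
    simpa only [Quaternion.coe_add, Quaternion.coe_neg] using h2
  have h4 : ‖w‖ < ‖z‖ := by simpa [dist_eq_norm] using hdist
  nlinarith [norm_nonneg w, norm_nonneg z, sq_nonneg ‖z + w‖]

/-- The pairs `(u, w)` with `⟪w, v⟫ = ⟪u, T v⟫` for all `v ∈ D(T)`. -/
def adjointGraph (T : H →ₗ.[ℍᵐᵒᵖ] H) : Submodule ℍᵐᵒᵖ (H × H) where
  carrier := {p | ∀ v : T.domain, inner ℍ p.2 (v : H) = inner ℍ p.1 (T v)}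
  zero_mem' := by
    intro v
    rw [← QuaternionicInnerProductSpace.star_inner,
      ← QuaternionicInnerProductSpace.star_inner (0 : H × H).1]
    simp only [Prod.fst_zero, Prod.snd_zero, inner_zero_right]
  add_mem' := by
    intro p r hp hr v
    simp only [Prod.fst_add, Prod.snd_add, inner_add_left, hp v, hr v]
  smul_mem' := by
    intro c p hp v
    have h := hp v
    simp only [Prod.smul_fst, Prod.smul_snd]
    rw [← MulOpposite.op_unop c, inner_smul_left, inner_smul_left, h]

/-- The adjoint `T*` of a densely defined operator: the operator whose graph is `adjointGraph T`. -/
noncomputable def adjoint (T : H →ₗ.[ℍᵐᵒᵖ] H) : H →ₗ.[ℍᵐᵒᵖ] H := (adjointGraph T).toLinearPMap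

theorem mem_adjoint_domain (T : H →ₗ.[ℍᵐᵒᵖ] H) (u : H) :
    u ∈ (adjoint T).domain ↔ ∃ w : H, ∀ v : T.domain, inner ℍ w (v : H) = inner ℍ u (T v) := by
  simp [adjoint, Submodule.toLinearPMap_domain, adjointGraph]

theorem inner_adjoint (T : H →ₗ.[ℍᵐᵒᵖ] H) (hT : Dense (T.domain : Set H))
    (u : (adjoint T).domain) (v : T.domain) :
    inner ℍ (adjoint T u) (v : H) = inner ℍ (u : H) (T v) := by
  refine Submodule.mem_graph_toLinearPMap (g := adjointGraph T) ?_ u v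
  rintro ⟨x, y⟩ hxy (rfl : x = 0)
  refine eq_zero_of_dense hT fun v hv => ?_
  have h := hxy ⟨v, hv⟩
  rw [← QuaternionicInnerProductSpace.star_inner (0 : H), inner_zero_right, star_zero] at h
  exact h

/-- `T = T*`. -/
def IsSelfAdjoint (T : H →ₗ.[ℍᵐᵒᵖ] H) : Prop := T = adjoint T

/-- `T = -T*`. -/
def IsAntiSelfAdjoint (T : H →ₗ.[ℍᵐᵒᵖ] H) : Prop := T = -adjoint T

/-- `T ∈ 𝔅(H)` and `T T* = T* T`. -/
def IsNormal (T : H →ₗ.[ℍᵐᵒᵖ] H) : Prop :=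
  T ∈ boundedOperators H ∧ mul T (adjoint T) = mul (adjoint T) T

/-- `D(T) = H` and `T T* = T* T = I`. -/
def IsUnitary (T : H →ₗ.[ℍᵐᵒᵖ] H) : Prop :=
  T.domain = ⊤ ∧ mul T (adjoint T) = one ∧ mul (adjoint T) T = one

end Adjoint

end QuatOp

/-!
Choosing `ℂ ⊂ ℍ` turns `H` into a complex Hilbert space, on which every right `ℍ`-linear
operator `T` is complex linear with the same adjoint. If `z = re q + i |im q|`, then
`Δ_q(T) = T² - (z + z̄) T + z z̄ = (T - z) (T - z̄)`, so `q ∈ ρ_S(T)` as soon as `T - z` and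
`T - z̄` are boundedly invertible. This locates the spectrum of self-adjoint, anti self-adjoint and
unitary operators by the classical arguments for `T - z`.

For the residual spectrum, let `k ⟂ Ran Δ_q(T)`. If `T` is normal, then so is `Δ_q(T)`, and
`k ∈ Ker Δ_q(T)* = Ker Δ_q(T)`. If `T` is self-adjoint, or anti self-adjoint with `re q = 0`, then
`Δ_q(T)` is symmetric and becomes surjective after adding a real constant, which again forces
`k ∈ Ker Δ_q(T)`. In each case an injective `Δ_q(T)` has dense range.
-/

section InnerProduct

variable {𝕜 E : Type*} [RCLike 𝕜] [NormedAddCommGroup E] [InnerProductSpace 𝕜 E]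

open RCLike ComplexConjugate

theorem mul_norm_le_norm_of_mul_sq_le_norm_inner {c : ℝ} {x v : E}
    (h : c * ‖x‖ ^ 2 ≤ ‖inner 𝕜 x v‖) : c * ‖x‖ ≤ ‖v‖ := by
  rcases (norm_nonneg x).eq_or_lt with hx | hx
  · simp [← hx]
  · refine le_of_mul_le_mul_left ?_ hx
    calc ‖x‖ * (c * ‖x‖) = c * ‖x‖ ^ 2 := by ring
      _ ≤ ‖inner 𝕜 x v‖ := h
      _ ≤ ‖x‖ * ‖v‖ := norm_inner_le_norm x v

theorem inner_sub_smul_self_right (x y : E) (z : 𝕜) :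
    inner 𝕜 x (y - z • x) = inner 𝕜 x y - z * ((‖x‖ ^ 2 : ℝ) : 𝕜) := by
  rw [inner_sub_right, inner_smul_right, inner_self_eq_norm_sq_to_K, ofReal_pow]

theorem abs_im_mul_norm_le_norm_sub_smul {x y : E} (h : im (inner 𝕜 x y) = 0) (z : 𝕜) :
    |im z| * ‖x‖ ≤ ‖y - z • x‖ := by
  refine mul_norm_le_norm_of_mul_sq_le_norm_inner (𝕜 := 𝕜) ?_
  calc |im z| * ‖x‖ ^ 2 = |im (inner 𝕜 x (y - z • x))| := by
        rw [inner_sub_smul_self_right, map_sub, h, im_mul_ofReal, zero_sub, abs_neg, abs_mul,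
          abs_of_nonneg (sq_nonneg ‖x‖)]
    _ ≤ ‖inner 𝕜 x (y - z • x)‖ := abs_im_le_norm _

theorem abs_re_mul_norm_le_norm_sub_smul {x y : E} (h : re (inner 𝕜 x y) = 0) (z : 𝕜) :
    |re z| * ‖x‖ ≤ ‖y - z • x‖ := by
  refine mul_norm_le_norm_of_mul_sq_le_norm_inner (𝕜 := 𝕜) ?_
  calc |re z| * ‖x‖ ^ 2 = |re (inner 𝕜 x (y - z • x))| := by
        rw [inner_sub_smul_self_right, map_sub, h, re_mul_ofReal, zero_sub, abs_neg, abs_mul,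
          abs_of_nonneg (sq_nonneg ‖x‖)]
    _ ≤ ‖inner 𝕜 x (y - z • x)‖ := abs_re_le_norm _

end InnerProduct

/-- A linear relation on `E`. It plays the role of the graph of a partially defined operator, and
`Submodule.adjoint` that of the graph of its adjoint. -/
abbrev LinearRelation (𝕜 E : Type*) [RCLike 𝕜] [NormedAddCommGroup E] [InnerProductSpace 𝕜 E] :=
  Submodule 𝕜 (E × E)

namespace LinearRelation

open RCLike ComplexConjugate

variable {𝕜 E : Type*} [RCLike 𝕜] [NormedAddCommGroup E] [InnerProductSpace 𝕜 E]

section Adjoint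

theorem mem_adjoint_iff_forall_inner_eq {G : LinearRelation 𝕜 E} {u w : E} :
    (u, w) ∈ G.adjoint ↔ ∀ x y, (x, y) ∈ G → inner 𝕜 y u = inner 𝕜 x w := by
  simp only [Submodule.mem_adjoint_iff, sub_eq_zero]

theorem isClosed_adjoint (G : LinearRelation 𝕜 E) : IsClosed (G.adjoint : Set (E × E)) := by
  have h : (G.adjoint : Set (E × E)) =
      ⋂ g ∈ G, {p | inner 𝕜 g.2 p.1 = inner 𝕜 g.1 p.2} := by
    ext ⟨u, w⟩
    simp only [SetLike.mem_coe, mem_adjoint_iff_forall_inner_eq, Set.mem_iInter,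
      Set.mem_ofPred_eq, Prod.forall]
  rw [h]
  exact isClosed_biInter fun g _ =>
    isClosed_eq (continuous_const.inner continuous_fst) (continuous_const.inner continuous_snd)

/-- A set of pairs is symmetric if, viewed as the graph of an operator `A`, it satisfies
`⟪A x, u⟫ = ⟪x, A u⟫`. -/
def IsSymmetric (𝕜 : Type*) {E : Type*} [RCLike 𝕜] [NormedAddCommGroup E] [InnerProductSpace 𝕜 E]
    (S : Set (E × E)) : Prop :=
  ∀ ⦃x y u v : E⦄, (x, y) ∈ S → (u, v) ∈ S → inner 𝕜 y u = inner 𝕜 x v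

/-- The graph of an operator `A` with `A⋆ = -A`. -/
def IsSkewAdjoint (G : LinearRelation 𝕜 E) : Prop :=
  ∀ u w, (u, w) ∈ G.adjoint ↔ (u, -w) ∈ G

variable {G : LinearRelation 𝕜 E}

theorem isSymmetric_of_adjoint_eq (hG : G.adjoint = G) : IsSymmetric 𝕜 (G : Set (E × E)) :=
  fun x y _ _ hx hu => mem_adjoint_iff_forall_inner_eq.mp (hG.ge hu) x y hx

theorem IsSymmetric.im_inner_eq_zero {S : Set (E × E)} (hS : IsSymmetric 𝕜 S) {x y : E}
    (h : (x, y) ∈ S) : im (inner 𝕜 x y) = 0 := by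
  rw [← conj_eq_iff_im, inner_conj_symm]
  exact hS h h

theorem IsSkewAdjoint.inner_eq_neg (hG : IsSkewAdjoint G) {x y u v : E} (hx : (x, y) ∈ G)
    (hu : (u, v) ∈ G) : inner 𝕜 y u = -inner 𝕜 x v := by
  rw [← inner_neg_right]
  exact mem_adjoint_iff_forall_inner_eq.mp ((hG u (-v)).mpr (by rwa [neg_neg])) x y hx

theorem IsSkewAdjoint.re_inner_eq_zero (hG : IsSkewAdjoint G) {x y : E} (h : (x, y) ∈ G) :
    re (inner 𝕜 x y) = 0 := by
  have hre : re (inner 𝕜 y x) = -re (inner 𝕜 x y) := by rw [hG.inner_eq_neg h h, map_neg]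
  rw [inner_re_symm] at hre
  exact self_eq_neg.mp hre

theorem IsSkewAdjoint.isClosed (hG : IsSkewAdjoint G) : IsClosed (G : Set (E × E)) := by
  have h : (G : Set (E × E)) = (fun p => (p.1, -p.2)) ⁻¹' (G.adjoint : Set (E × E)) := by
    ext ⟨u, w⟩
    simp only [Set.mem_preimage, SetLike.mem_coe, hG u, neg_neg]
  rw [h]
  exact G.isClosed_adjoint.preimage (continuous_fst.prodMk continuous_snd.neg)

end Adjoint

section RegularPoint

/-- `z` lies in the resolvent set of the operator `A` with graph `G`: the operator `A - z` is
surjective and bounded below. -/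
structure IsRegularPoint (G : LinearRelation 𝕜 E) (z : 𝕜) : Prop where
  exists_norm_le : ∃ K : ℝ, ∀ x y, (x, y) ∈ G → ‖x‖ ≤ K * ‖y - z • x‖
  exists_sub_smul_eq : ∀ h, ∃ x y, (x, y) ∈ G ∧ y - z • x = h

variable [CompleteSpace E] {G : LinearRelation 𝕜 E}

theorem isClosed_range_sub_smul (hG : IsClosed (G : Set (E × E))) {z : 𝕜} {c : ℝ} (hc : 0 < c)
    (hbound : ∀ x y, (x, y) ∈ G → c * ‖x‖ ≤ ‖y - z • x‖) :
    IsClosed (G.map (LinearMap.snd 𝕜 E E - z • LinearMap.fst 𝕜 E E) : Set E) := by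
  let f : G →L[𝕜] E :=
    (ContinuousLinearMap.snd 𝕜 E E - z • ContinuousLinearMap.fst 𝕜 E E).comp G.subtypeL
  have hf (g : G) : ‖g‖ ≤ (c⁻¹ + 1 + ‖z‖ * c⁻¹) * ‖f g‖ := by
    obtain ⟨⟨x, y⟩, hxy⟩ := g
    have hx : ‖x‖ ≤ c⁻¹ * ‖y - z • x‖ := (le_inv_mul_iff₀ hc).mpr (hbound x y hxy)
    have hy : ‖y‖ ≤ ‖y - z • x‖ + ‖z‖ * ‖x‖ := by
      rw [← norm_smul]
      exact norm_le_norm_sub_add y (z • x)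
    calc ‖(x, y)‖ ≤ ‖x‖ + ‖y‖ := max_le_add_of_nonneg (norm_nonneg x) (norm_nonneg y)
      _ ≤ ‖x‖ + (‖y - z • x‖ + ‖z‖ * ‖x‖) := by gcongr
      _ ≤ c⁻¹ * ‖y - z • x‖ + (‖y - z • x‖ + ‖z‖ * (c⁻¹ * ‖y - z • x‖)) := by gcongr
      _ = (c⁻¹ + 1 + ‖z‖ * c⁻¹) * ‖y - z • x‖ := by ring
  have : CompleteSpace G := hG.completeSpace_coe
  have hrange : (G.map (LinearMap.snd 𝕜 E E - z • LinearMap.fst 𝕜 E E) : Set E) = Set.range f := by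
    ext h
    simp [f]
  rw [hrange]
  exact (AddMonoidHomClass.antilipschitz_of_bound f (K := ⟨_, by positivity⟩) hf).isClosed_range
    f.uniformContinuous

theorem isRegularPoint_of_mul_norm_le (hG : IsClosed (G : Set (E × E))) {z : 𝕜} {c : ℝ} (hc : 0 < c)
    (hbound : ∀ x y, (x, y) ∈ G → c * ‖x‖ ≤ ‖y - z • x‖)
    (hadj : ∀ x, (x, conj z • x) ∈ G.adjoint → x = 0) : IsRegularPoint G z where
  exists_norm_le := ⟨c⁻¹, fun x y h => (le_inv_mul_iff₀ hc).mpr (hbound x y h)⟩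
  exists_sub_smul_eq := by
    set R := G.map (LinearMap.snd 𝕜 E E - z • LinearMap.fst 𝕜 E E)
    have : CompleteSpace R := (isClosed_range_sub_smul hG hc hbound).completeSpace_coe
    have htop : R = ⊤ := by
      refine Submodule.orthogonal_eq_bot_iff.mp ((Submodule.eq_bot_iff _).mpr fun k hk => ?_)
      refine hadj k (mem_adjoint_iff_forall_inner_eq.mpr fun x y hxy => ?_)
      have hxk := (Submodule.mem_orthogonal R k).mp hk _ (Submodule.mem_map_of_mem hxy)
      simpa [inner_sub_left, inner_smul_left, inner_smul_right, sub_eq_zero] using hxk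
    intro h
    obtain ⟨⟨x, y⟩, hxy, rfl⟩ := Submodule.mem_map.mp (htop.ge (Submodule.mem_top (x := h)))
    exact ⟨x, y, hxy, rfl⟩

theorem isRegularPoint_of_adjoint_eq (hG : G.adjoint = G) {z : 𝕜} (hz : im z ≠ 0) :
    IsRegularPoint G z := by
  have hbound (w : 𝕜) (x y : E) (h : (x, y) ∈ G) : |im w| * ‖x‖ ≤ ‖y - w • x‖ :=
    abs_im_mul_norm_le_norm_sub_smul ((isSymmetric_of_adjoint_eq hG).im_inner_eq_zero h) w
  have hclosed : IsClosed (G : Set (E × E)) := hG ▸ G.isClosed_adjoint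
  refine isRegularPoint_of_mul_norm_le hclosed (abs_pos.mpr hz) (hbound z) fun x hx => ?_
  have hx₀ : |im z| * ‖x‖ ≤ 0 := by simpa using hbound (conj z) x _ (hG.le hx)
  exact norm_le_zero_iff.mp (nonpos_of_mul_nonpos_right hx₀ (abs_pos.mpr hz))

theorem IsSkewAdjoint.isRegularPoint (hG : IsSkewAdjoint G) {z : 𝕜} (hz : re z ≠ 0) :
    IsRegularPoint G z := by
  have hbound (w : 𝕜) (x y : E) (h : (x, y) ∈ G) : |re w| * ‖x‖ ≤ ‖y - w • x‖ :=
    abs_re_mul_norm_le_norm_sub_smul (hG.re_inner_eq_zero h) w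
  refine isRegularPoint_of_mul_norm_le hG.isClosed (abs_pos.mpr hz) (hbound z) fun x hx => ?_
  have hx₀ : |re z| * ‖x‖ ≤ 0 := by simpa using hbound (-conj z) x _ ((hG _ _).mp hx)
  exact norm_le_zero_iff.mp (nonpos_of_mul_nonpos_right hx₀ (abs_pos.mpr hz))

end RegularPoint

section Quadratic

/-- The graph of the operator `A ^ 2 - s A + p` on the domain of `A ^ 2`, where `G` is the graph
of `A`. -/
def quadratic (G : LinearRelation 𝕜 E) (s p : 𝕜) : Set (E × E) :=
  {g | ∃ x₁ x₂, (g.1, x₁) ∈ G ∧ (x₁, x₂) ∈ G ∧ g.2 = x₂ - s • x₁ + p • g.1}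

variable {G : LinearRelation 𝕜 E} {z w s p : 𝕜}

theorem mem_quadratic {x y : E} : (x, y) ∈ quadratic G s p ↔
    ∃ x₁ x₂, (x, x₁) ∈ G ∧ (x₁, x₂) ∈ G ∧ y = x₂ - s • x₁ + p • x :=
  Iff.rfl

theorem mem_quadratic_add_smul {x y : E} (h : (x, y) ∈ quadratic G s p) (c : 𝕜) :
    (x, y + c • x) ∈ quadratic G s (p + c) := by
  obtain ⟨x₁, x₂, h₁, h₂, rfl⟩ := mem_quadratic.mp h
  exact ⟨x₁, x₂, h₁, h₂, by module⟩

theorem IsRegularPoint.exists_mem_quadratic (hz : IsRegularPoint G z) (hw : IsRegularPoint G w)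
    (h : E) : ∃ x, (x, h) ∈ quadratic G (z + w) (z * w) := by
  obtain ⟨u, v, huv, rfl⟩ := hz.exists_sub_smul_eq h
  obtain ⟨x, y, hxy, rfl⟩ := hw.exists_sub_smul_eq u
  refine ⟨x, y, v + w • y, hxy, ?_, by module⟩
  simpa using G.add_mem huv (G.smul_mem w hxy)

theorem IsRegularPoint.exists_norm_le_of_mem_quadratic (hz : IsRegularPoint G z)
    (hw : IsRegularPoint G w) :
    ∃ K : ℝ, ∀ x y, (x, y) ∈ quadratic G (z + w) (z * w) → ‖x‖ ≤ K * ‖y‖ := by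
  obtain ⟨K, hK⟩ := hz.exists_norm_le
  obtain ⟨M, hM⟩ := hw.exists_norm_le
  refine ⟨|M| * K, fun x y hxy => ?_⟩
  obtain ⟨x₁, x₂, h₁, h₂, rfl⟩ := mem_quadratic.mp hxy
  calc ‖x‖ ≤ |M| * ‖x₁ - w • x‖ := (hM x x₁ h₁).trans (by gcongr; exact le_abs_self M)
    _ ≤ |M| * (K * ‖(x₂ - w • x₁) - z • (x₁ - w • x)‖) := by
        gcongr
        exact hK _ _ (G.sub_mem h₂ (G.smul_mem w h₁))
    _ = |M| * K * ‖x₂ - (z + w) • x₁ + (z * w) • x‖ := by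
        rw [mul_assoc]
        congr 3
        module

theorem IsSymmetric.quadratic (hG : IsSymmetric 𝕜 (G : Set (E × E))) (hs : conj s = s)
    (hp : conj p = p) : IsSymmetric 𝕜 (quadratic G s p) := by
  intro x y u v hxy huv
  obtain ⟨x₁, x₂, h₁, h₂, rfl⟩ := mem_quadratic.mp hxy
  obtain ⟨u₁, u₂, k₁, k₂, rfl⟩ := mem_quadratic.mp huv
  have h : inner 𝕜 x₂ u = inner 𝕜 x u₂ := (hG h₂ k₁).trans (hG h₁ k₂)
  simp only [inner_add_left, inner_sub_left, inner_smul_left, inner_add_right, inner_sub_right,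
    inner_smul_right, hs, hp, h, hG h₁ k₁]

theorem IsSkewAdjoint.isSymmetric_quadratic (hG : IsSkewAdjoint G) (hp : conj p = p) :
    IsSymmetric 𝕜 (LinearRelation.quadratic G 0 p) := by
  intro x y u v hxy huv
  obtain ⟨x₁, x₂, h₁, h₂, rfl⟩ := mem_quadratic.mp hxy
  obtain ⟨u₁, u₂, k₁, k₂, rfl⟩ := mem_quadratic.mp huv
  have h : inner 𝕜 x₂ u = inner 𝕜 x u₂ := by
    rw [hG.inner_eq_neg h₂ k₁, hG.inner_eq_neg h₁ k₂, neg_neg]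
  simp only [zero_smul, sub_zero, inner_add_left, inner_smul_left, inner_add_right,
    inner_smul_right, hp, h]

theorem IsSymmetric.mem_of_forall_inner_eq_zero {S : Set (E × E)} (hS : IsSymmetric 𝕜 S) {c : 𝕜}
    (hc : conj c = c) (hsurj : ∀ h, ∃ x, (x, h - c • x) ∈ S) {k : E}
    (hk : ∀ x y, (x, y) ∈ S → inner 𝕜 y k = 0) : (k, 0) ∈ S := by
  obtain ⟨x, hx⟩ := hsurj (c • k)
  have hxk : x = k := by
    refine ext_inner_right 𝕜 fun g => ?_
    obtain ⟨v, hv⟩ := hsurj g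
    have hxg : inner 𝕜 x g = c * inner 𝕜 k v := by
      have := hS hx hv
      simp only [inner_sub_left, inner_sub_right, inner_smul_left, inner_smul_right, hc] at this
      linear_combination -this
    have hkg : inner 𝕜 k g = c * inner 𝕜 k v := by
      have := inner_eq_zero_symm.mp (hk _ _ hv)
      simp only [inner_sub_right, inner_smul_right] at this
      linear_combination this
    rw [hxg, hkg]
  rw [hxk, sub_self] at hx
  exact hx

theorem IsRegularPoint.mem_quadratic_of_forall_inner_eq_zero (hz : IsRegularPoint G z)
    (hw : IsRegularPoint G w) (hs : z + w = s) (hp : conj (z * w - p) = z * w - p)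
    (hsymm : IsSymmetric 𝕜 (quadratic G s p)) {k : E}
    (hk : ∀ x y, (x, y) ∈ quadratic G s p → inner 𝕜 y k = 0) : (k, 0) ∈ quadratic G s p := by
  refine hsymm.mem_of_forall_inner_eq_zero hp (fun h => ?_) hk
  obtain ⟨x, hx⟩ := hz.exists_mem_quadratic hw h
  have hx' := mem_quadratic_add_smul hx (p - z * w)
  rw [hs, add_sub_cancel, ← neg_sub, neg_smul, ← sub_eq_add_neg] at hx'
  exact ⟨x, hx'⟩

end Quadratic

section Bounded

theorem mem_graph_coe {L : E →L[𝕜] E} {x y : E} : (x, y) ∈ (L : E →ₗ[𝕜] E).graph ↔ y = L x :=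
  Iff.rfl

theorem isRegularPoint_graph {L : E →L[𝕜] E} {z : 𝕜} (hz : z ∉ spectrum 𝕜 L) :
    IsRegularPoint (L : E →ₗ[𝕜] E).graph z := by
  obtain ⟨u, hu⟩ := spectrum.notMem_iff.mp hz
  have hu_apply (x : E) : (u : E →L[𝕜] E) x = z • x - L x := by
    rw [hu, sub_apply, ContinuousLinearMap.algebraMap_apply]
  have hinv (x : E) : (↑u⁻¹ : E →L[𝕜] E) ((u : E →L[𝕜] E) x) = x :=
    DFunLike.congr_fun u.inv_mul x
  have hinv' (x : E) : (u : E →L[𝕜] E) ((↑u⁻¹ : E →L[𝕜] E) x) = x :=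
    DFunLike.congr_fun u.mul_inv x
  constructor
  · refine ⟨‖(↑u⁻¹ : E →L[𝕜] E)‖, fun x y hxy => ?_⟩
    obtain rfl := mem_graph_coe.mp hxy
    calc ‖x‖ = ‖(↑u⁻¹ : E →L[𝕜] E) (z • x - L x)‖ := by rw [← hu_apply, hinv]
      _ ≤ ‖(↑u⁻¹ : E →L[𝕜] E)‖ * ‖z • x - L x‖ := ContinuousLinearMap.le_opNorm _ _
      _ = ‖(↑u⁻¹ : E →L[𝕜] E)‖ * ‖L x - z • x‖ := by rw [norm_sub_rev]
  · intro h
    refine ⟨(↑u⁻¹ : E →L[𝕜] E) (-h), _, mem_graph_coe.mpr rfl, ?_⟩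
    have := hinv' (-h)
    rw [hu_apply] at this
    rw [← neg_sub]
    exact neg_eq_iff_eq_neg.mpr this

/-- The operator `L ^ 2 - s L + p`. -/
noncomputable def quadraticCLM (L : E →L[𝕜] E) (s p : 𝕜) : E →L[𝕜] E :=
  L * L - s • L + p • (1 : E →L[𝕜] E)

theorem mem_quadratic_graph {L : E →L[𝕜] E} {s p : 𝕜} {x y : E} :
    (x, y) ∈ quadratic (L : E →ₗ[𝕜] E).graph s p ↔ y = quadraticCLM L s p x := by
  simp only [mem_quadratic, mem_graph_coe]
  constructor
  · rintro ⟨_, _, rfl, rfl, rfl⟩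
    rfl
  · rintro rfl
    exact ⟨_, _, rfl, rfl, rfl⟩

variable [CompleteSpace E]

theorem adjoint_graph (L : E →L[𝕜] E) :
    (L : E →ₗ[𝕜] E).graph.adjoint = (ContinuousLinearMap.adjoint L : E →ₗ[𝕜] E).graph := by
  ext ⟨u, w⟩
  simp only [mem_adjoint_iff_forall_inner_eq, mem_graph_coe]
  constructor
  · intro h
    refine ext_inner_left 𝕜 fun x => ?_
    rw [← h x _ rfl]
    exact (ContinuousLinearMap.adjoint_inner_right L x u).symm
  · rintro rfl x _ rfl
    exact (ContinuousLinearMap.adjoint_inner_right L x u).symm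

theorem star_quadraticCLM (L : E →L[𝕜] E) (s p : 𝕜) :
    star (quadraticCLM L s p) = quadraticCLM (star L) (conj s) (conj p) := by
  simp only [quadraticCLM, star_add, star_sub, star_mul, star_smul, star_one, starRingEnd_apply]

theorem isStarNormal_quadraticCLM (L : E →L[𝕜] E) [IsStarNormal L] (s p : 𝕜) :
    IsStarNormal (quadraticCLM L s p) := by
  have hcomm {M N : E →L[𝕜] E} (h : Commute M N) (s p : 𝕜) : Commute M (quadraticCLM N s p) :=
    ((h.mul_right h).sub_right (h.smul_right s)).add_right ((Commute.one_right M).smul_right p)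
  refine ⟨?_⟩
  rw [star_quadraticCLM]
  exact hcomm (hcomm (star_comm_self' L).symm _ _).symm _ _

theorem norm_quadraticCLM_star_apply (L : E →L[𝕜] E) [IsStarNormal L] {s p : 𝕜}
    (hs : conj s = s) (hp : conj p = p) (x : E) :
    ‖quadraticCLM (star L) s p x‖ = ‖quadraticCLM L s p x‖ := by
  have h := ContinuousLinearMap.isStarNormal_iff_norm_eq_adjoint.mp
    (isStarNormal_quadraticCLM L s p) x
  rw [h, ← ContinuousLinearMap.star_eq_adjoint, star_quadraticCLM, hs, hp]

theorem mem_quadratic_graph_of_forall_inner_eq_zero (L : E →L[𝕜] E) [IsStarNormal L] {s p : 𝕜}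
    {k : E} (hk : ∀ x y, (x, y) ∈ quadratic (L : E →ₗ[𝕜] E).graph s p → inner 𝕜 y k = 0) :
    (k, 0) ∈ quadratic (L : E →ₗ[𝕜] E).graph s p := by
  have := isStarNormal_quadraticCLM L s p
  have hmem : k ∈ (quadraticCLM L s p).rangeᗮ := by
    rw [Submodule.mem_orthogonal]
    rintro _ ⟨x, rfl⟩
    exact hk x _ (mem_quadratic_graph.mpr rfl)
  rw [ContinuousLinearMap.IsStarNormal.orthogonal_range this] at hmem
  exact mem_quadratic_graph.mpr (LinearMap.mem_ker.mp hmem).symm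

end Bounded

end LinearRelation

namespace QuatOp

section Quaternions

open ComplexConjugate

/-- The complex part `a + b i` of the quaternion `a + b i + c j + d k`. -/
def complexPart (p : ℍ) : ℂ := ⟨p.re, p.imI⟩

theorem complexPart_star (p : ℍ) : complexPart (star p) = conj (complexPart p) := by
  apply Complex.ext <;> simp [complexPart]

theorem complexPart_star_coe_mul (z : ℂ) (p : ℍ) :
    complexPart (star (z : ℍ) * p) = conj z * complexPart p := by
  apply Complex.ext <;> simp [complexPart]

theorem complexPart_add (p q : ℍ) : complexPart (p + q) = complexPart p + complexPart q := by
  apply Complex.ext <;> simp [complexPart]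

theorem norm_coeComplex (z : ℂ) : ‖(z : ℍ)‖ = ‖z‖ := by
  refine (sq_eq_sq₀ (norm_nonneg _) (norm_nonneg _)).mp ?_
  rw [sq ‖(z : ℍ)‖, ← Quaternion.normSq_eq_norm_mul_self, ← Complex.normSq_eq_norm_sq]
  simp only [Quaternion.normSq_def', Complex.normSq_apply, Quaternion.re_coeComplex,
    Quaternion.imI_coeComplex, Quaternion.imJ_coeComplex, Quaternion.imK_coeComplex]
  ring

theorem eq_of_complexPart_star_mul_eq {p r : ℍ}
    (h : ∀ q : ℍ, complexPart (star q * p) = complexPart (star q * r)) : p = r := by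
  have hre : (star (p - r) * p).re = (star (p - r) * r).re := congrArg Complex.re (h (p - r))
  have hself : (star (p - r) * (p - r)).re = 0 := by
    rw [mul_sub, Quaternion.re_sub, hre, sub_self]
  rw [Quaternion.star_mul_self, Quaternion.re_coe, Quaternion.normSq_eq_zero] at hself
  exact sub_eq_zero.mp hself

/-- The element of the closed upper half-plane of `ℂ` that is conjugate to `q` in `ℍ`. -/
noncomputable def complexRepresentative (q : ℍ) : ℂ := ⟨q.re, ‖q.im‖⟩

theorem complexRepresentative_add_conj (q : ℍ) :
    complexRepresentative q + conj (complexRepresentative q) = ((2 * q.re : ℝ) : ℂ) :=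
  Complex.add_conj _

theorem complexRepresentative_mul_conj (q : ℍ) :
    complexRepresentative q * conj (complexRepresentative q) = ((‖q‖ ^ 2 : ℝ) : ℂ) := by
  rw [Complex.mul_conj]
  congr 1
  simp only [Complex.normSq_mk, complexRepresentative, sq, ← Quaternion.normSq_eq_norm_mul_self,
    Quaternion.normSq_def', Quaternion.re_im, Quaternion.imI_im, Quaternion.imJ_im,
    Quaternion.imK_im]
  ring

theorem norm_complexRepresentative (q : ℍ) : ‖complexRepresentative q‖ = ‖q‖ := by
  have h := complexRepresentative_mul_conj q
  rw [Complex.mul_conj, Complex.normSq_eq_norm_sq, Complex.ofReal_inj] at h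
  exact (sq_eq_sq₀ (norm_nonneg _) (norm_nonneg q)).mp h

theorem mem_real_of_im_eq_zero {q : ℍ} (h : q.im = 0) : q ∈ real :=
  ⟨q.re, by conv_rhs => rw [← q.re_add_im, h, add_zero]⟩

theorem mem_imaginary_iff {q : ℍ} : q ∈ imaginary ↔ q.re = 0 :=
  eq_comm.trans (by simp [Quaternion.ext_iff, eq_comm])

end Quaternions

section Graph

variable {H : Type*} [NormedAddCommGroup H] [Module ℍᵐᵒᵖ H]

theorem mem_graph_mul (S T : H →ₗ.[ℍᵐᵒᵖ] H) (x y : H) :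
    (x, y) ∈ (mul S T).graph ↔ ∃ z, (x, z) ∈ T.graph ∧ (z, y) ∈ S.graph := by
  constructor
  · intro h
    obtain ⟨⟨v, hv, hv'⟩, rfl, rfl⟩ := (mul S T).mem_graph_iff.mp h
    exact ⟨_, T.mem_graph ⟨v, hv⟩, S.mem_graph ⟨_, hv'⟩⟩
  · rintro ⟨z, h₁, h₂⟩
    obtain ⟨⟨v, hv⟩, rfl, rfl⟩ := T.mem_graph_iff.mp h₁
    obtain ⟨⟨w, hw⟩, h, rfl⟩ := S.mem_graph_iff.mp h₂
    obtain rfl : w = T ⟨v, hv⟩ := h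
    exact (mul S T).mem_graph ⟨v, hv, hw⟩

theorem mem_graph_neg (A : H →ₗ.[ℍᵐᵒᵖ] H) (x y : H) :
    (x, y) ∈ (-A).graph ↔ (x, -y) ∈ A.graph := by
  have h : ∀ (B : H →ₗ.[ℍᵐᵒᵖ] H) (y : H), (x, y) ∈ B.graph → (x, -y) ∈ (-B).graph := by
    intro B y hy
    obtain ⟨v, rfl, rfl⟩ := B.mem_graph_iff.mp hy
    exact (-B).mem_graph v
  exact ⟨fun hxy => by simpa using h _ _ hxy, fun hxy => by simpa using h _ _ hxy⟩

theorem mem_graph_one (x y : H) : (x, y) ∈ (one : H →ₗ.[ℍᵐᵒᵖ] H).graph ↔ y = x := by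
  rw [LinearPMap.mem_graph_iff]
  constructor
  · rintro ⟨v, rfl, rfl⟩
    rfl
  · rintro rfl
    exact ⟨⟨y, Submodule.mem_top⟩, rfl, rfl⟩

theorem ker_eq_bot_iff (A : H →ₗ.[ℍᵐᵒᵖ] H) :
    ker A = ⊥ ↔ ∀ x, (x, (0 : H)) ∈ A.graph → x = 0 := by
  rw [ker, LinearMap.ker_eq_bot']
  constructor
  · intro h x hx
    obtain ⟨v, rfl, hv⟩ := A.mem_graph_iff.mp hx
    simpa using h v hv
  · intro h v hv
    refine Subtype.ext (h _ ?_)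
    have := A.mem_graph v
    rwa [show A v = 0 from hv] at this

theorem mem_ran_iff (A : H →ₗ.[ℍᵐᵒᵖ] H) (y : H) : y ∈ ran A ↔ ∃ x, (x, y) ∈ A.graph :=
  A.mem_range_iff

theorem isBdd_inverse_iff {A : H →ₗ.[ℍᵐᵒᵖ] H} (hA : ker A = ⊥) :
    IsBdd A.inverse ↔ ∃ K : ℝ, ∀ x y, (x, y) ∈ A.graph → ‖x‖ ≤ K * ‖y‖ := by
  constructor
  · rintro ⟨K, hK⟩
    refine ⟨K, fun x y h => ?_⟩
    obtain ⟨v, rfl, rfl⟩ := A.mem_graph_iff.mp h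
    have h₁ := hK ⟨A v, by rw [LinearPMap.inverse_domain]; exact ⟨v, rfl⟩⟩
    rwa [LinearPMap.inverse_apply_eq hA (x := v) rfl] at h₁
  · rintro ⟨K, hK⟩
    refine ⟨K, fun u => ?_⟩
    obtain ⟨v, hv⟩ := A.inverse_domain.le u.2
    rw [LinearPMap.inverse_apply_eq hA (x := v) hv]
    have := hK _ _ (A.mem_graph v)
    rwa [show A v = u from hv] at this

theorem ker_eq_bot_of_bound {A : H →ₗ.[ℍᵐᵒᵖ] H} {K : ℝ}
    (hK : ∀ x y, (x, y) ∈ A.graph → ‖x‖ ≤ K * ‖y‖) : ker A = ⊥ :=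
  (ker_eq_bot_iff A).mpr fun x hx => by simpa using hK x 0 hx

theorem residualSpectrum_eq_empty_iff (T : H →ₗ.[ℍᵐᵒᵖ] H) :
    residualSpectrum T = ∅ ↔
      ∀ q, ker (delta T q) = ⊥ → Dense (ran (delta T q) : Set H) := by
  simp only [residualSpectrum, Set.eq_empty_iff_forall_notMem, Set.mem_ofPred_eq, not_and, not_not,
    dense_iff_closure_eq]

theorem mem_continuousSpectrum_iff {T : H →ₗ.[ℍᵐᵒᵖ] H} (hr : residualSpectrum T = ∅) (q : ℍ) :
    q ∈ continuousSpectrum T ↔ ker (delta T q) = ⊥ ∧ ¬ IsBdd (delta T q).inverse := by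
  refine and_congr_right fun hker => and_iff_right ?_
  exact ((residualSpectrum_eq_empty_iff T).mp hr q hker).closure_eq

theorem pointSpectrum_subset_spectrum (T : H →ₗ.[ℍᵐᵒᵖ] H) : pointSpectrum T ⊆ spectrum T :=
  fun _ hq hq' => hq hq'.1

end Graph

section ComplexStructure

variable {H : Type*} [NormedAddCommGroup H] [Module ℍᵐᵒᵖ H]

/-- The inclusion of `ℂ` into `ℍᵐᵒᵖ`, through which `ℂ` acts by right multiplication. -/
noncomputable def complexToOpposite : ℂ →+* ℍᵐᵒᵖ :=
  (Quaternion.ofComplex : ℂ →+* ℍ).toOpposite fun z w => by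
    rw [Commute, SemiconjBy, ← map_mul, ← map_mul, mul_comm]

/-- The structure of complex vector space on `ℍᵐᵒᵖ`. -/
@[reducible] noncomputable def complexModule : Module ℂ ℍᵐᵒᵖ :=
  Module.compHom ℍᵐᵒᵖ complexToOpposite

attribute [local instance] complexModule

variable [QuaternionicInnerProductSpace H]

theorem norm_op_smul (q : ℍ) (x : H) : ‖MulOpposite.op q • x‖ = ‖q‖ * ‖x‖ := by
  have h : ((‖MulOpposite.op q • x‖ ^ 2 : ℝ) : ℍ) = ((‖q‖ * ‖x‖) ^ 2 : ℝ) := by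
    rw [← QuaternionicInnerProductSpace.inner_self, inner_smul_left,
      QuaternionicInnerProductSpace.inner_smul_right, QuaternionicInnerProductSpace.inner_self,
      Quaternion.coe_commutes, ← mul_assoc, Quaternion.star_mul_self,
      Quaternion.normSq_eq_norm_mul_self, ← Quaternion.coe_mul]
    ring_nf
  exact (sq_eq_sq₀ (norm_nonneg _) (by positivity)).mp (Quaternion.coe_injective h)

/-- The complex inner product `complexPart ⟪u, v⟫` on a quaternionic inner product space. -/
@[reducible] noncomputable def complexInnerProductSpace : InnerProductSpace ℂ H where
  __ := Module.compHom H complexToOpposite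
  inner x y := complexPart (inner ℍ x y)
  norm_smul_le z x :=
     ((norm_op_smul (z : ℍ) x).trans (by rw [norm_coeComplex])).le
  norm_sq_eq_re_inner x := by
    rw [QuaternionicInnerProductSpace.inner_self]
    rfl
  conj_inner_symm x y := by
    rw [← complexPart_star, QuaternionicInnerProductSpace.star_inner]
  add_left x y z := by rw [inner_add_left, complexPart_add]
  smul_left x y z := (congrArg complexPart (inner_smul_left x y z)).trans
    (complexPart_star_coe_mul z _)

attribute [local instance] complexInnerProductSpace

/-- The graph of a right `ℍ`-linear operator, seen as a complex linear relation. -/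
noncomputable def complexGraph (T : H →ₗ.[ℍᵐᵒᵖ] H) : LinearRelation ℂ H :=
  have : IsScalarTower ℂ ℍᵐᵒᵖ H := ⟨fun z q x => mul_smul (complexToOpposite z) q x⟩
  T.graph.restrictScalars ℂ

theorem mem_complexGraph {T : H →ₗ.[ℍᵐᵒᵖ] H} {x y : H} :
    (x, y) ∈ complexGraph T ↔ (x, y) ∈ T.graph :=
  Iff.rfl

theorem ofReal_smul_eq (r : ℝ) (x : H) : (r : ℂ) • x = MulOpposite.op (r : ℍ) • x := by
  change MulOpposite.op (((r : ℂ) : ℍ)) • x = _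
  rw [Quaternion.coeComplex_coe]

theorem mem_graph_delta {T : H →ₗ.[ℍᵐᵒᵖ] H} {q : ℍ} {x y : H} :
    (x, y) ∈ (delta T q).graph ↔
      (x, y) ∈ (complexGraph T).quadratic ((2 * q.re : ℝ) : ℂ) ((‖q‖ ^ 2 : ℝ) : ℂ) := by
  have hq : ((2 * q.re : ℝ) : ℍ) = q + star q := (Quaternion.self_add_star' q).symm
  simp only [LinearRelation.mem_quadratic, mem_complexGraph, ofReal_smul_eq, hq]
  constructor
  · intro h
    obtain ⟨⟨v, hv, hv'⟩, rfl, rfl⟩ := (delta T q).mem_graph_iff.mp h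
    exact ⟨_, _, T.mem_graph ⟨v, hv⟩, T.mem_graph ⟨_, hv'⟩, rfl⟩
  · rintro ⟨x₁, x₂, h₁, h₂, rfl⟩
    obtain ⟨⟨v, hv⟩, rfl, rfl⟩ := T.mem_graph_iff.mp h₁
    obtain ⟨⟨w, hw⟩, h, rfl⟩ := T.mem_graph_iff.mp h₂
    obtain rfl : w = T ⟨v, hv⟩ := h
    exact (delta T q).mem_graph ⟨v, hv, hw⟩

theorem mem_graph_adjoint {T : H →ₗ.[ℍᵐᵒᵖ] H} (hT : Dense (T.domain : Set H)) {u w : H} :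
    (u, w) ∈ (adjoint T).graph ↔ ∀ x y, (x, y) ∈ T.graph → inner ℍ x w = inner ℍ y u := by
  have hgraph : (adjoint T).graph = adjointGraph T :=
    Submodule.toLinearPMap_graph_eq _ fun ⟨_, y⟩ hxy hx => eq_zero_of_dense hT fun v hv => by
      have h := hxy ⟨v, hv⟩
      rwa [show _ = (0 : H) from hx, ← QuaternionicInnerProductSpace.star_inner (0 : H),
        inner_zero_right, star_zero] at h
  have hstar (x y : H) : inner ℍ x w = inner ℍ y u ↔ inner ℍ w x = inner ℍ u y := by
    rw [← star_inj, QuaternionicInnerProductSpace.star_inner,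
      QuaternionicInnerProductSpace.star_inner]
  simp only [hgraph, hstar]
  constructor
  · intro h x y hxy
    obtain ⟨v, rfl, rfl⟩ := T.mem_graph_iff.mp hxy
    exact h v
  · exact fun h v => h _ _ (T.mem_graph v)

theorem complexGraph_adjoint {T : H →ₗ.[ℍᵐᵒᵖ] H} (hT : Dense (T.domain : Set H)) :
    complexGraph (adjoint T) = (complexGraph T).adjoint := by
  ext ⟨u, w⟩
  rw [mem_complexGraph, mem_graph_adjoint hT, LinearRelation.mem_adjoint_iff_forall_inner_eq]
  constructor
  · exact fun h x y hxy => congrArg complexPart (h x y hxy).symm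
  · intro h x y hxy
    -- The complex parts suffice because `T` commutes with all right multiplications.
    refine eq_of_complexPart_star_mul_eq fun q => ?_
    have hq := h _ _ (T.graph.smul_mem (MulOpposite.op q) hxy)
    rw [← inner_smul_left, ← inner_smul_left]
    exact hq.symm

section Resolvent

open ComplexConjugate

variable {T : H →ₗ.[ℍᵐᵒᵖ] H}

theorem mem_resolventSet_of_isRegularPoint {q : ℍ}
    (hz : (complexGraph T).IsRegularPoint (complexRepresentative q))
    (hz' : (complexGraph T).IsRegularPoint (conj (complexRepresentative q))) :
    q ∈ resolventSet T := by
  have hsurj := hz.exists_mem_quadratic hz'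
  obtain ⟨K, hK⟩ := hz.exists_norm_le_of_mem_quadratic hz'
  rw [complexRepresentative_add_conj, complexRepresentative_mul_conj] at hsurj hK
  simp only [← mem_graph_delta] at hsurj hK
  have hker := ker_eq_bot_of_bound hK
  refine ⟨hker, ?_, (isBdd_inverse_iff hker).mpr ⟨K, hK⟩⟩
  exact dense_univ.mono fun y _ => (mem_ran_iff _ y).mpr (hsurj y)

variable [CompleteSpace H]

theorem dense_of_forall_inner_eq_zero {K : Submodule ℍᵐᵒᵖ H}
    (hK : ∀ k : H, (∀ y ∈ K, inner ℂ y k = 0) → k = 0) : Dense (K : Set H) := by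
  have : IsScalarTower ℂ ℍᵐᵒᵖ H := ⟨fun z q x => mul_smul (complexToOpposite z) q x⟩
  refine (Submodule.dense_iff_topologicalClosure_eq_top (s := K.restrictScalars ℂ)).mpr ?_
  rw [Submodule.topologicalClosure_eq_top_iff, Submodule.eq_bot_iff]
  exact fun k hk => hK k ((Submodule.mem_orthogonal _ k).mp hk)

theorem notMem_residualSpectrum {q : ℍ}
    (h : ∀ k, (∀ x y, (x, y) ∈ (delta T q).graph → inner ℂ y k = 0) → (k, 0) ∈ (delta T q).graph) :
    q ∉ residualSpectrum T := by
  rintro ⟨hker, hran⟩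
  refine hran (dense_of_forall_inner_eq_zero fun k hk => ?_).closure_eq
  exact (ker_eq_bot_iff _).mp hker k
    (h k fun x y hxy => hk y ((mem_ran_iff _ y).mpr ⟨x, hxy⟩))

end Resolvent

section SelfAdjoint

open ComplexConjugate

variable {T : H →ₗ.[ℍᵐᵒᵖ] H}

theorem IsSelfAdjoint.adjoint_complexGraph (h : IsSelfAdjoint T) (hT : Dense (T.domain : Set H)) :
    (complexGraph T).adjoint = complexGraph T := by
  rw [← complexGraph_adjoint hT, ← show T = adjoint T from h]

variable [CompleteSpace H]

theorem IsSelfAdjoint.spectrum_subset_real (h : IsSelfAdjoint T)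
    (hT : Dense (T.domain : Set H)) : spectrum T ⊆ real := by
  intro q hq
  by_contra hreal
  have him : (complexRepresentative q).im ≠ 0 := fun h0 =>
    hreal (mem_real_of_im_eq_zero (norm_eq_zero.mp h0))
  have hG := h.adjoint_complexGraph hT
  exact hq (mem_resolventSet_of_isRegularPoint (LinearRelation.isRegularPoint_of_adjoint_eq hG him)
    (LinearRelation.isRegularPoint_of_adjoint_eq hG (neg_ne_zero.mpr him)))

theorem IsSelfAdjoint.residualSpectrum_eq_empty (h : IsSelfAdjoint T)
    (hT : Dense (T.domain : Set H)) : residualSpectrum T = ∅ := by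
  refine Set.eq_empty_iff_forall_notMem.mpr fun q => notMem_residualSpectrum fun k hk => ?_
  simp only [mem_graph_delta] at hk ⊢
  have hG := h.adjoint_complexGraph hT
  have hsymm := (LinearRelation.isSymmetric_of_adjoint_eq hG).quadratic
    (Complex.conj_ofReal (2 * q.re)) (Complex.conj_ofReal (‖q‖ ^ 2))
  -- The roots of `Δ_q` may be real; `q.re ± i` are regular points with the same sum.
  let z : ℂ := ⟨q.re, 1⟩
  have hz : (complexGraph T).IsRegularPoint z :=
    LinearRelation.isRegularPoint_of_adjoint_eq hG one_ne_zero
  have hz' : (complexGraph T).IsRegularPoint (conj z) :=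
    LinearRelation.isRegularPoint_of_adjoint_eq hG (neg_ne_zero.mpr one_ne_zero)
  refine hz.mem_quadratic_of_forall_inner_eq_zero hz' (Complex.add_conj z) ?_ hsymm hk
  rw [Complex.mul_conj, ← Complex.ofReal_sub, Complex.conj_ofReal]

end SelfAdjoint

section AntiSelfAdjoint

variable {T : H →ₗ.[ℍᵐᵒᵖ] H}

theorem IsAntiSelfAdjoint.isSkewAdjoint (h : IsAntiSelfAdjoint T) (hT : Dense (T.domain : Set H)) :
    (complexGraph T).IsSkewAdjoint := by
  intro u w
  rw [← complexGraph_adjoint hT, mem_complexGraph, mem_complexGraph]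
  nth_rw 2 [show T = -adjoint T from h]
  rw [mem_graph_neg, neg_neg]

theorem IsAntiSelfAdjoint.unitSphere_subset_pointSpectrum [Nontrivial H] (h : IsAntiSelfAdjoint T)
    (hu : IsUnitary T) : unitSphere ⊆ pointSpectrum T := by
  rintro q ⟨him, hq⟩ hker
  obtain ⟨x, hx⟩ := exists_ne (0 : H)
  refine hx ((ker_eq_bot_iff _).mp hker x (mem_graph_delta.mpr ?_))
  have hx₁ : (x, x) ∈ (mul (adjoint T) T).graph := by rw [hu.2.2, mem_graph_one]
  obtain ⟨y, hxy, hyx⟩ := (mem_graph_mul _ _ x x).mp hx₁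
  have hyx' : (y, -x) ∈ T.graph := by
    rwa [show T = -adjoint T from h, mem_graph_neg, neg_neg]
  refine ⟨y, -x, hxy, hyx', ?_⟩
  simp [mem_imaginary_iff.mp him, hq]

variable [CompleteSpace H]

theorem IsAntiSelfAdjoint.spectrum_subset_imaginary (h : IsAntiSelfAdjoint T)
    (hT : Dense (T.domain : Set H)) : spectrum T ⊆ imaginary := by
  intro q hq
  by_contra hre
  rw [mem_imaginary_iff] at hre
  have hG := h.isSkewAdjoint hT
  exact hq (mem_resolventSet_of_isRegularPoint (hG.isRegularPoint hre) (hG.isRegularPoint hre))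

theorem IsAntiSelfAdjoint.residualSpectrum_eq_empty (h : IsAntiSelfAdjoint T)
    (hT : Dense (T.domain : Set H)) : residualSpectrum T = ∅ := by
  refine Set.eq_empty_iff_forall_notMem.mpr fun q hq => ?_
  have hre : q.re = 0 := mem_imaginary_iff.mp
    (h.spectrum_subset_imaginary hT fun hres => hq.2 hres.2.1.closure_eq)
  refine notMem_residualSpectrum (fun k hk => ?_) hq
  simp only [mem_graph_delta, hre, mul_zero, Complex.ofReal_zero] at hk ⊢
  have hG := h.isSkewAdjoint hT
  have hsymm := hG.isSymmetric_quadratic (Complex.conj_ofReal (‖q‖ ^ 2))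
  have hz := hG.isRegularPoint (z := 1) (by simp)
  have hw := hG.isRegularPoint (z := -1) (by simp)
  exact hz.mem_quadratic_of_forall_inner_eq_zero hw (add_neg_cancel 1) (by simp) hsymm hk

end AntiSelfAdjoint

section Bounded

open LinearRelation

variable {T : H →ₗ.[ℍᵐᵒᵖ] H} {L : H →L[ℂ] H}

theorem exists_complexGraph_eq_graph (hT : T ∈ boundedOperators H) :
    ∃ L : H →L[ℂ] H, complexGraph T = (L : H →ₗ[ℂ] H).graph := by
  obtain ⟨htop, K, hK⟩ := hT
  have hdom (x : H) : x ∈ T.domain := htop ▸ Submodule.mem_top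
  let f : H →ₗ[ℂ] H :=
    { toFun := fun x => T ⟨x, hdom x⟩
      map_add' := fun x y => T.map_add ⟨x, hdom x⟩ ⟨y, hdom y⟩
      map_smul' := fun z x => T.map_smul (complexToOpposite z) ⟨x, hdom x⟩ }
  refine ⟨f.mkContinuous K fun x => hK ⟨x, hdom x⟩, ?_⟩
  ext ⟨x, y⟩
  rw [mem_complexGraph, LinearPMap.mem_graph_iff, mem_graph_coe]
  constructor
  · rintro ⟨v, rfl, rfl⟩
    rfl
  · rintro rfl
    exact ⟨⟨x, hdom x⟩, rfl, rfl⟩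

theorem mem_graph_mul_iff {S : H →ₗ.[ℍᵐᵒᵖ] H} {M : H →L[ℂ] H}
    (hM : complexGraph S = (M : H →ₗ[ℂ] H).graph) (hL : complexGraph T = (L : H →ₗ[ℂ] H).graph)
    {x y : H} : (x, y) ∈ (mul S T).graph ↔ y = (M * L) x := by
  rw [mem_graph_mul]
  simp only [← mem_complexGraph (T := S), ← mem_complexGraph (T := T), hL, hM, mem_graph_coe,
    exists_eq_left]
  rfl

theorem mem_graph_delta_iff (hL : complexGraph T = (L : H →ₗ[ℂ] H).graph) {q : ℍ} {x y : H} :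
    (x, y) ∈ (delta T q).graph ↔
      y = quadraticCLM L ((2 * q.re : ℝ) : ℂ) ((‖q‖ ^ 2 : ℝ) : ℂ) x := by
  rw [mem_graph_delta, hL, mem_quadratic_graph]

variable [CompleteSpace H]

theorem complexGraph_adjoint_eq_graph (hT : Dense (T.domain : Set H))
    (hL : complexGraph T = (L : H →ₗ[ℂ] H).graph) :
    complexGraph (adjoint T) = ((star L : H →L[ℂ] H) : H →ₗ[ℂ] H).graph := by
  rw [complexGraph_adjoint hT, hL, adjoint_graph, ContinuousLinearMap.star_eq_adjoint]

theorem residualSpectrum_eq_empty_of_isStarNormal [IsStarNormal L]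
    (hL : complexGraph T = (L : H →ₗ[ℂ] H).graph) : residualSpectrum T = ∅ := by
  refine Set.eq_empty_iff_forall_notMem.mpr fun q => notMem_residualSpectrum fun k hk => ?_
  simp only [mem_graph_delta, hL] at hk ⊢
  exact mem_quadratic_graph_of_forall_inner_eq_zero L hk

theorem ker_delta_adjoint_eq_bot_iff [IsStarNormal L] (hT : Dense (T.domain : Set H))
    (hL : complexGraph T = (L : H →ₗ[ℂ] H).graph) (q : ℍ) :
    ker (delta (adjoint T) q) = ⊥ ↔ ker (delta T q) = ⊥ := by
  simp only [ker_eq_bot_iff, mem_graph_delta_iff hL,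
    mem_graph_delta_iff (complexGraph_adjoint_eq_graph hT hL), eq_comm (a := (0 : H))]
  refine forall_congr' fun x => imp_congr_left ?_
  rw [← norm_eq_zero, norm_quadraticCLM_star_apply L (Complex.conj_ofReal _)
    (Complex.conj_ofReal _), norm_eq_zero]

theorem isBdd_inverse_delta_adjoint_iff [IsStarNormal L] (hT : Dense (T.domain : Set H))
    (hL : complexGraph T = (L : H →ₗ[ℂ] H).graph) {q : ℍ} (hker : ker (delta T q) = ⊥) :
    IsBdd (delta (adjoint T) q).inverse ↔ IsBdd (delta T q).inverse := by
  rw [isBdd_inverse_iff hker, isBdd_inverse_iff ((ker_delta_adjoint_eq_bot_iff hT hL q).mpr hker)]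
  simp only [mem_graph_delta_iff hL, mem_graph_delta_iff (complexGraph_adjoint_eq_graph hT hL),
    forall_eq, norm_quadraticCLM_star_apply L (Complex.conj_ofReal _) (Complex.conj_ofReal _)]

theorem isStarNormal_of_mul_adjoint (hT : Dense (T.domain : Set H))
    (hL : complexGraph T = (L : H →ₗ[ℂ] H).graph)
    (h : mul T (adjoint T) = mul (adjoint T) T) : IsStarNormal L := by
  have hL' := complexGraph_adjoint_eq_graph hT hL
  refine ⟨ContinuousLinearMap.ext fun x => (mem_graph_mul_iff hL hL').mp ?_⟩
  rw [h]
  exact (mem_graph_mul_iff hL' hL).mpr rfl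

theorem IsNormal.spectra_adjoint (h : IsNormal T) (hT : Dense (T.domain : Set H)) :
    pointSpectrum T = pointSpectrum (adjoint T) ∧
      residualSpectrum T = ∅ ∧ residualSpectrum (adjoint T) = ∅ ∧
      continuousSpectrum T = continuousSpectrum (adjoint T) := by
  obtain ⟨L, hL⟩ := exists_complexGraph_eq_graph h.1
  have := isStarNormal_of_mul_adjoint hT hL h.2
  have hker := ker_delta_adjoint_eq_bot_iff hT hL
  have hres := residualSpectrum_eq_empty_of_isStarNormal hL
  have hres' := residualSpectrum_eq_empty_of_isStarNormal (complexGraph_adjoint_eq_graph hT hL)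
  refine ⟨Set.ext fun q => (hker q).not.symm, hres, hres', Set.ext fun q => ?_⟩
  rw [mem_continuousSpectrum_iff hres, mem_continuousSpectrum_iff hres', hker]
  exact and_congr_right fun hq => (isBdd_inverse_delta_adjoint_iff hT hL hq).not.symm

theorem IsUnitary.mem_unitary (h : IsUnitary T) (hT : Dense (T.domain : Set H))
    (hL : complexGraph T = (L : H →ₗ[ℂ] H).graph) : L ∈ unitary (H →L[ℂ] H) := by
  have hL' := complexGraph_adjoint_eq_graph hT hL
  refine Unitary.mem_iff.mpr
    ⟨ContinuousLinearMap.ext fun x => ?_, ContinuousLinearMap.ext fun x => ?_⟩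
  · refine ((mem_graph_mul_iff hL' hL).mp ?_).symm
    rw [h.2.2, mem_graph_one]
    rfl
  · refine ((mem_graph_mul_iff hL hL').mp ?_).symm
    rw [h.2.1, mem_graph_one]
    rfl

theorem IsUnitary.spectrum_subset (h : IsUnitary T) (hb : T ∈ boundedOperators H)
    (hT : Dense (T.domain : Set H)) : spectrum T ⊆ {q : ℍ | ‖q‖ = 1} := by
  obtain ⟨L, hL⟩ := exists_complexGraph_eq_graph hb
  have hregular {z : ℂ} (hz : ‖z‖ ≠ 1) : (complexGraph T).IsRegularPoint z := by
    rw [hL]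
    exact isRegularPoint_graph fun hmem =>
      hz (_root_.spectrum.norm_eq_one_of_unitary (h.mem_unitary hT hL) hmem)
  intro q hq
  by_contra hnorm
  rw [Set.mem_ofPred_eq, ← norm_complexRepresentative] at hnorm
  exact hq (mem_resolventSet_of_isRegularPoint (hregular hnorm)
    (hregular (by rwa [Complex.norm_conj])))

end Bounded

theorem IsAntiSelfAdjoint.spectrum_eq_unitSphere [CompleteSpace H] [Nontrivial H]
    {T : H →ₗ.[ℍᵐᵒᵖ] H} (h : IsAntiSelfAdjoint T) (hu : IsUnitary T)
    (hb : T ∈ boundedOperators H) (hT : Dense (T.domain : Set H)) :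
    spectrum T = pointSpectrum T ∧ pointSpectrum T = unitSphere := by
  have hsphere := h.unitSphere_subset_pointSpectrum hu
  have hpoint := pointSpectrum_subset_spectrum T
  have hspectrum : spectrum T ⊆ unitSphere := fun q hq =>
    ⟨h.spectrum_subset_imaginary hT hq, hu.spectrum_subset hb hT hq⟩
  exact ⟨(hspectrum.trans hsphere).antisymm hpoint, (hpoint.trans hspectrum).antisymm hsphere⟩

end ComplexStructure

end QuatOp

theorem mainTheorem7 {H : Type*} [NormedAddCommGroup H] [Module ℍᵐᵒᵖ H]
    [QuaternionicInnerProductSpace H] [CompleteSpace H] [Nontrivial H]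
    (T : H →ₗ.[ℍᵐᵒᵖ] H) (hT : Dense (T.domain : Set H)) :
    (T ∈ QuatOp.boundedOperators H → QuatOp.IsNormal T →
      QuatOp.pointSpectrum T = QuatOp.pointSpectrum (QuatOp.adjoint T) ∧
      QuatOp.residualSpectrum T = ∅ ∧ QuatOp.residualSpectrum (QuatOp.adjoint T) = ∅ ∧
      QuatOp.continuousSpectrum T = QuatOp.continuousSpectrum (QuatOp.adjoint T)) ∧
    (QuatOp.IsSelfAdjoint T →
      QuatOp.spectrum T ⊆ QuatOp.real ∧ QuatOp.residualSpectrum T = ∅) ∧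
    (QuatOp.IsAntiSelfAdjoint T →
      QuatOp.spectrum T ⊆ QuatOp.imaginary ∧ QuatOp.residualSpectrum T = ∅) ∧
    (T ∈ QuatOp.boundedOperators H → QuatOp.IsUnitary T →
      QuatOp.spectrum T ⊆ {q : ℍ | ‖q‖ = 1}) ∧
    (T ∈ QuatOp.boundedOperators H → QuatOp.IsAntiSelfAdjoint T → QuatOp.IsUnitary T →
      QuatOp.spectrum T = QuatOp.pointSpectrum T ∧
      QuatOp.pointSpectrum T = QuatOp.unitSphere) :=
  ⟨fun _ h => h.spectra_adjoint hT,
    fun h => ⟨h.spectrum_subset_real hT, h.residualSpectrum_eq_empty hT⟩,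
    fun h => ⟨h.spectrum_subset_imaginary hT, h.residualSpectrum_eq_empty hT⟩,
    fun hb h => h.spectrum_subset hb hT,
    fun hb ha h => ha.spectrum_eq_unitSphere h hb hT⟩
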